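/- Let $S$ be a commutative semiring. A cartesian left-additive category is a category with finite products (regarded as a symmetric monoidal category $(\times, 1)$ with copy maps $\Delta_A$ and discard maps $!_A$) in which every object $A$ carries a commutative monoid $+_A : A\times A\to A$, $0_A : 1\to A$, compatibly with products of objects. It is cartesian distributive if every object moreover carries a commutative monoid $\cdot_A : A\times A\to A$, $1_A : 1\to A$, compatibly with products of objects, such that $\cdot_A$ distributes over $+_A$ and is annihilated by $0_A$. A reverse derivative category is a cartesian left-additive category with an operator $R$ sending each $f : A\to B$ to $R[f] : A\times B\to A$ such that, in elements, 1. $R[\mathrm{id}_A](x,d)=d$; $R[\Delta_A](x,(d,d'))=d+d'$; $R[!_A](x,\ast)=0$; $R[+_A]((x,y),d)=(d,d)$; $R[0_A]=\,!$; $R[\mathrm{twist}_{A,B}]((x,y),(d,e))=(e,d)$; $R[f ; g](x,d)=R[f](x,R[g](f(x),d))$; $R[f\times g]((x,y),(d,e))=(R[f](x,d),R[g](y,e))$ (and $R$ of an associator or unitor is its inverse applied to the change $d$); 2. $R[f](x,d+d')=R[f](x,d)+R[f](x,d')$ and $R[f](x,0)=0$; 3. $D_B[R[f]](x,(d,d'))=R[f](x,d')$;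 4. $D[D[f]]((x,a),(b,c))=D[D[f]]((x,b),(a,c))$; where $D[f](x,a)$ is the second component of $R[R[f]]((x,0),a)$ and $D_B[g](x,(d,d'))=D[g]((x,d),(0,d'))$. Let $\mathrm{PolyCirc}_S$ be the cartesian distributive category presented by one generating object (so its objects are the natural numbers, with $m\otimes n=m+n$), a generating morphism $s : 0\to 1$ for each $s\in S$, and, for all $s,t\in S$, the equations saying that the constant $0\in S$ is the zero map $0_1$, the constant $1\in S$ is the unit map $1_1$, and $(s\otimes t);+_1 = s+t$ and $(s\otimes t);\cdot_1 = s\cdot t$, where the right-hand sides are the constants given by the sum and the product in $S$. That is, its morphisms are the terms built from the generators, the structure maps, composition and $\otimes$, modulo the axioms of strict cartesian distributive categories and these equations. Then $\mathrm{PolyCirc}_S$ is a reverse derivative category, with a combinator $R$ such that $R[\cdot_A]((x,y),d)=(y\cdot d,\;x\cdot d)$ and $R[1_A]$ is the discard map for every object $A$, and $R[s] : 1\to 0$ is the discard map for every constant $s\in S$. -/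

import Mathlib

open CategoryTheory MonoidalCategory CartesianMonoidalCategory

universe v u

/-! ### Cartesian left-additive and cartesian distributive categories -/

/-- A cartesian left-additive category: a cartesian category in which every object `A` carries a
commutative monoid `(add A, zero A)`, compatibly with the monoidal product of objects. The
symmetric monoidal structure, the copy maps `lift (𝟙 A) (𝟙 A)` and the discard maps `toUnit A` are
those of `CartesianMonoidalCategory` and `BraidedCategory`. -/
class CartesianLeftAdditiveCategory (C : Type u) [Category.{v} C] [CartesianMonoidalCategory C]
    [BraidedCategory C] where
  add : ∀ A : C, A ⊗ A ⟶ A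
  zero : ∀ A : C, 𝟙_ C ⟶ A
  add_comm : ∀ A : C, (β_ A A).hom ≫ add A = add A
  add_assoc : ∀ A : C, add A ▷ A ≫ add A = (α_ A A A).hom ≫ A ◁ add A ≫ add A
  zero_add : ∀ A : C, zero A ▷ A ≫ add A = (λ_ A).hom
  add_tensor : ∀ A B : C, add (A ⊗ B) = tensorμ A B A B ≫ (add A ⊗ₘ add B)
  zero_tensor : ∀ A B : C, zero (A ⊗ B) = (λ_ (𝟙_ C)).inv ≫ (zero A ⊗ₘ zero B)

/-- A cartesian distributive category: a cartesian left-additive category in which every object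
moreover carries a commutative monoid `(mul A, one A)`, compatibly with the monoidal product of
objects, such that multiplication distributes over addition and is annihilated by zero. -/
class CartesianDistributiveCategory (C : Type u) [Category.{v} C] [CartesianMonoidalCategory C]
    [BraidedCategory C] extends CartesianLeftAdditiveCategory C where
  mul : ∀ A : C, A ⊗ A ⟶ A
  one : ∀ A : C, 𝟙_ C ⟶ A
  mul_comm : ∀ A : C, (β_ A A).hom ≫ mul A = mul A
  mul_assoc : ∀ A : C, mul A ▷ A ≫ mul A = (α_ A A A).hom ≫ A ◁ mul A ≫ mul A
  one_mul : ∀ A : C, one A ▷ A ≫ mul A = (λ_ A).hom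
  mul_tensor : ∀ A B : C, mul (A ⊗ B) = tensorμ A B A B ≫ (mul A ⊗ₘ mul B)
  one_tensor : ∀ A B : C, one (A ⊗ B) = (λ_ (𝟙_ C)).inv ≫ (one A ⊗ₘ one B)
  mul_add : ∀ A : C, A ◁ add A ≫ mul A =
    lift (𝟙 A) (𝟙 A) ▷ (A ⊗ A) ≫ tensorμ A A A A ≫ (mul A ⊗ₘ mul A) ≫ add A
  mul_zero : ∀ A : C, A ◁ zero A ≫ mul A = toUnit (A ⊗ 𝟙_ C) ≫ zero A

/-! ### Reverse derivative categories -/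

section ReverseDerivative

open CartesianLeftAdditiveCategory

variable {C : Type u} [Category.{v} C] [CartesianMonoidalCategory C] [BraidedCategory C]
  [CartesianLeftAdditiveCategory C]

/-- The forward derivative attached to an operator `R` of the type of a reverse differential
combinator: insert a zero in the middle input of `R[R[f]]` and keep the second output. -/
def forwardDerivative (R : ∀ {A B : C}, (A ⟶ B) → (A ⊗ B ⟶ A)) {A B : C} (f : A ⟶ B) :
    A ⊗ A ⟶ B :=
  ((ρ_ A).inv ≫ A ◁ zero B) ▷ A ≫ R (R f) ≫ snd A B

/-- The partial derivative of `g : A ⊗ B ⟶ Z` with respect to `B`: in elements,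
`(a, (b, b')) ↦ D[g]((a, b), (0, b'))`. -/
def partialDerivative (R : ∀ {A B : C}, (A ⟶ B) → (A ⊗ B ⟶ A)) {A B Z : C} (g : A ⊗ B ⟶ Z) :
    A ⊗ (B ⊗ B) ⟶ Z :=
  lift (A ◁ fst B B) ((toUnit A ≫ zero A) ⊗ₘ snd B B) ≫ forwardDerivative R g

variable (C) in
/-- The structure of a reverse derivative category on a cartesian left-additive category: a reverse
differential combinator `R` satisfying the four groups of axioms below. -/
structure ReverseDerivativeCategory where
  R : ∀ {A B : C}, (A ⟶ B) → (A ⊗ B ⟶ A)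
  /- Structural axioms. The rules for associators and unitors are instances of the rule for
  identities when the monoidal structure is strict. -/
  R_id : ∀ A : C, R (𝟙 A) = snd A A
  R_associator : ∀ A B Z : C, R (α_ A B Z).hom = snd _ _ ≫ (α_ A B Z).inv
  R_leftUnitor : ∀ A : C, R (λ_ A).hom = snd _ _ ≫ (λ_ A).inv
  R_rightUnitor : ∀ A : C, R (ρ_ A).hom = snd _ _ ≫ (ρ_ A).inv
  R_braiding : ∀ A B : C, R (β_ A B).hom = snd _ _ ≫ (β_ B A).hom
  R_copy : ∀ A : C, R (lift (𝟙 A) (𝟙 A)) = snd _ _ ≫ add A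
  R_discard : ∀ A : C, R (toUnit A) = toUnit _ ≫ zero A
  R_add : ∀ A : C, R (add A) = snd _ _ ≫ lift (𝟙 A) (𝟙 A)
  R_zero : ∀ A : C, R (zero A) = toUnit _
  R_comp : ∀ {A B Z : C} (f : A ⟶ B) (g : B ⟶ Z),
    R (f ≫ g) = lift (fst A Z) (f ▷ Z ≫ R g) ≫ R f
  R_tensor : ∀ {A B A' B' : C} (f : A ⟶ A') (g : B ⟶ B'),
    R (f ⊗ₘ g) = tensorμ A B A' B' ≫ (R f ⊗ₘ R g)
  /- Additivity of change. -/
  R_change_add : ∀ {A B : C} (f : A ⟶ B),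
    A ◁ add B ≫ R f = lift (A ◁ fst B B ≫ R f) (A ◁ snd B B ≫ R f) ≫ add A
  R_change_zero : ∀ {A B : C} (f : A ⟶ B),
    A ◁ zero B ≫ R f = toUnit _ ≫ zero A
  /- Linearity of change. -/
  R_change_linear : ∀ {A B : C} (f : A ⟶ B),
    partialDerivative R (R f) = A ◁ snd B B ≫ R f
  /- Symmetry of partial derivatives. -/
  partials_symm : ∀ {A B : C} (f : A ⟶ B),
    forwardDerivative R (forwardDerivative R f) =
      tensorμ A A A A ≫ forwardDerivative R (forwardDerivative R f)

end ReverseDerivative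

/-! ### Polynomial circuits -/

/-- The category of polynomial circuits over `S`: the (strict) cartesian distributive category
presented by one generating object and generators and equations for the constants. Words in the
one generating object are identified with their lengths, so objects are natural numbers. -/
@[ext]
structure PolyCirc (S : Type u) : Type where
  /-- The number of wires. -/
  wires : ℕ

namespace PolyCirc

/-- Terms of polynomial circuits. The structure maps of a cartesian distributive category are
available at every object; the coherence equations in `Rel` reduce them to those of the generating
object `1`. -/
inductive Term (S : Type u) : ℕ → ℕ → Type u
  | ident (n : ℕ) : Term S n n
  | seq {m n p : ℕ} : Term S m n → Term S n p → Term S m p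
  | par {m n m' n' : ℕ} : Term S m n → Term S m' n' → Term S (m + m') (n + n')
  | twist (m n : ℕ) : Term S (m + n) (n + m)
  | copy (n : ℕ) : Term S n (n + n)
  | discard (n : ℕ) : Term S n 0
  | add (n : ℕ) : Term S (n + n) n
  | zero (n : ℕ) : Term S 0 n
  | mul (n : ℕ) : Term S (n + n) n
  | one (n : ℕ) : Term S 0 n
  | const (s : S) : Term S 0 1

namespace Term

variable {S : Type u}

/-- The identity term, between words that are equal. -/
def wire {m n : ℕ} (h : m = n) : Term S m n := h ▸ Term.ident m

/-- Swap the second and third blocks of wires. -/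
def swapMid (m n p q : ℕ) : Term S ((m + n) + (p + q)) ((m + p) + (n + q)) :=
  seq (wire (by omega : (m + n) + (p + q) = m + ((n + p) + q)))
    (seq (par (ident m) (par (twist n p) (ident q)))
      (wire (by omega : m + ((p + n) + q) = (m + p) + (n + q))))

end Term

open Term in
/-- The congruence on terms generated by the equations of strict symmetric monoidal categories, of
cartesian distributive categories, and of constants. -/
inductive Rel {S : Type u} [CommSemiring S] : ∀ {m n : ℕ}, Term S m n → Term S m n → Prop
  -- congruence
  | refl {m n} (f : Term S m n) : Rel f f
  | symm {m n} {f g : Term S m n} : Rel f g → Rel g f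
  | trans {m n} {f g h : Term S m n} : Rel f g → Rel g h → Rel f h
  | comp_congr {m n p} {f f' : Term S m n} {g g' : Term S n p} :
      Rel f f' → Rel g g' → Rel (seq f g) (seq f' g')
  | tensor_congr {m n m' n'} {f f' : Term S m n} {g g' : Term S m' n'} :
      Rel f f' → Rel g g' → Rel (par f g) (par f' g')
  -- category
  | id_comp {m n} (f : Term S m n) : Rel (seq (ident m) f) f
  | comp_id {m n} (f : Term S m n) : Rel (seq f (ident n)) f
  | comp_assoc {m n p q} (f : Term S m n) (g : Term S n p) (h : Term S p q) :
      Rel (seq (seq f g) h) (seq f (seq g h))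
  -- strict monoidal category
  | tensor_id (m n) : Rel (par (ident m) (ident n)) (ident (m + n))
  | tensor_comp {m n p m' n' p'} (f : Term S m n) (g : Term S n p) (f' : Term S m' n')
      (g' : Term S n' p') :
      Rel (par (seq f g) (seq f' g')) (seq (par f f') (par g g'))
  | tensor_assoc {m n m' n' m'' n''} (f : Term S m n) (g : Term S m' n') (h : Term S m'' n'') :
      Rel (seq (par (par f g) h) (wire (Nat.add_assoc n n' n'')))
        (seq (wire (Nat.add_assoc m m' m'')) (par f (par g h)))
  | unit_tensor {m n} (f : Term S m n) :
      Rel (seq (par (ident 0) f) (wire (Nat.zero_add n))) (seq (wire (Nat.zero_add m)) f)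
  | tensor_unit {m n} (f : Term S m n) :
      Rel (seq (par f (ident 0)) (wire (Nat.add_zero n))) (seq (wire (Nat.add_zero m)) f)
  -- symmetry
  | twist_twist (m n) : Rel (seq (twist m n) (twist n m)) (ident (m + n))
  | twist_natural {m n m' n'} (f : Term S m n) (g : Term S m' n') :
      Rel (seq (par f g) (twist n n')) (seq (twist m m') (par g f))
  | twist_tensor (m n p) :
      Rel (twist m (n + p))
        (seq (wire (Nat.add_assoc m n p).symm)
          (seq (par (twist m n) (ident p))
            (seq (wire (Nat.add_assoc n m p))
              (seq (par (ident n) (twist m p)) (wire (Nat.add_assoc n p m).symm)))))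
  -- commutative comonoids, naturality, coherence
  | copy_comm (n) : Rel (seq (copy n) (twist n n)) (copy n)
  | copy_assoc (n) :
      Rel (seq (copy n) (seq (par (copy n) (ident n)) (wire (Nat.add_assoc n n n))))
        (seq (copy n) (par (ident n) (copy n)))
  | copy_discard (n) :
      Rel (seq (copy n) (seq (par (discard n) (ident n)) (wire (Nat.zero_add n)))) (ident n)
  | copy_natural {m n} (f : Term S m n) : Rel (seq f (copy n)) (seq (copy m) (par f f))
  | discard_natural {m n} (f : Term S m n) : Rel (seq f (discard n)) (discard m)
  | copy_tensor (m n) :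
      Rel (copy (m + n)) (seq (par (copy m) (copy n)) (swapMid m m n n))
  | discard_tensor (m n) : Rel (discard (m + n)) (par (discard m) (discard n))
  -- additive commutative monoids, coherence
  | add_comm (n) : Rel (seq (twist n n) (add n)) (add n)
  | add_assoc (n) :
      Rel (seq (par (add n) (ident n)) (add n))
        (seq (wire (Nat.add_assoc n n n)) (seq (par (ident n) (add n)) (add n)))
  | zero_add (n) : Rel (seq (par (zero n) (ident n)) (add n)) (wire (Nat.zero_add n))
  | add_tensor (m n) :
      Rel (add (m + n)) (seq (swapMid m n m n) (par (add m) (add n)))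
  | zero_tensor (m n) : Rel (zero (m + n)) (par (zero m) (zero n))
  -- multiplicative commutative monoids, coherence
  | mul_comm (n) : Rel (seq (twist n n) (mul n)) (mul n)
  | mul_assoc (n) :
      Rel (seq (par (mul n) (ident n)) (mul n))
        (seq (wire (Nat.add_assoc n n n)) (seq (par (ident n) (mul n)) (mul n)))
  | one_mul (n) : Rel (seq (par (one n) (ident n)) (mul n)) (wire (Nat.zero_add n))
  | mul_tensor (m n) :
      Rel (mul (m + n)) (seq (swapMid m n m n) (par (mul m) (mul n)))
  | one_tensor (m n) : Rel (one (m + n)) (par (one m) (one n))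
  -- distributivity and annihilation
  | mul_add (n) :
      Rel (seq (par (ident n) (add n)) (mul n))
        (seq (par (copy n) (ident (n + n)))
          (seq (swapMid n n n n) (seq (par (mul n) (mul n)) (add n))))
  | mul_zero (n) :
      Rel (seq (par (ident n) (zero n)) (mul n)) (seq (discard (n + 0)) (zero n))
  -- constants
  | const_zero : Rel (const 0) (zero 1)
  | const_add (s t : S) : Rel (seq (par (const s) (const t)) (add 1)) (const (s + t))
  | const_one : Rel (const 1) (one 1)
  | const_mul (s t : S) : Rel (seq (par (const s) (const t)) (mul 1)) (const (s * t))

variable {S : Type u} [CommSemiring S]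

/-- The setoid of terms modulo the equations. -/
def setoid (S : Type u) [CommSemiring S] (m n : ℕ) : Setoid (Term S m n) where
  r := Rel
  iseqv := ⟨Rel.refl, Rel.symm, Rel.trans⟩

/-- Circuits with `m` inputs and `n` outputs: terms modulo the equations. -/
def Circ (S : Type u) [CommSemiring S] (m n : ℕ) : Type u := Quotient (setoid S m n)

/-- The circuit denoted by a term. -/
def ofTerm {m n : ℕ} (t : Term S m n) : Circ S m n := Quotient.mk (setoid S m n) t

theorem ofTerm_eq {m n : ℕ} {t t' : Term S m n} (h : Rel t t') : ofTerm t = ofTerm t' := Quotient.sound h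

/-- Sequential composition of circuits. -/
def Circ.comp {m n p : ℕ} : Circ S m n → Circ S n p → Circ S m p :=
  Quotient.map₂ Term.seq fun _ _ h _ _ h' => Rel.comp_congr h h'

/-- Parallel composition of circuits. -/
def Circ.tensor {m n m' n' : ℕ} : Circ S m n → Circ S m' n' → Circ S (m + m') (n + n') :=
  Quotient.map₂ Term.par fun _ _ h _ _ h' => Rel.tensor_congr h h'

instance : Category.{u} (PolyCirc S) where
  Hom m n := Circ S m.wires n.wires
  id n := ofTerm (Term.ident n.wires)
  comp f g := Circ.comp f g
  id_comp f := Quotient.inductionOn f fun f => ofTerm_eq (Rel.id_comp f)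
  comp_id f := Quotient.inductionOn f fun f => ofTerm_eq (Rel.comp_id f)
  assoc f g h := Quotient.inductionOn₃ f g h fun f g h => ofTerm_eq (Rel.comp_assoc f g h)

/-- The object of `PolyCirc S` with `n` wires. -/
abbrev obj (S : Type u) (n : ℕ) : PolyCirc S := ⟨n⟩

/-- The morphism denoted by a term. -/
def hom {m n : ℕ} (t : Term S m n) : obj S m ⟶ obj S n := ofTerm t


theorem hom_wire {m n : ℕ} (h : m = n) :
    hom (Term.wire h : Term S m n) = eqToHom (congrArg (obj S) h) := by
  subst h; rfl

instance : MonoidalCategoryStruct (PolyCirc S) where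
  tensorObj m n := obj S (m.wires + n.wires)
  tensorUnit := obj S 0
  tensorHom f g := Circ.tensor f g
  whiskerLeft m _ _ f := Circ.tensor (ofTerm (Term.ident m.wires)) f
  whiskerRight f n := Circ.tensor f (ofTerm (Term.ident n.wires))
  associator m n p := eqToIso (PolyCirc.ext (Nat.add_assoc m.wires n.wires p.wires))
  leftUnitor m := eqToIso (PolyCirc.ext (Nat.zero_add m.wires))
  rightUnitor m := eqToIso (PolyCirc.ext (Nat.add_zero m.wires))

theorem tensorHom_eqToHom {m n m' n' : PolyCirc S} (h : m = n) (h' : m' = n') :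
    (eqToHom h ⊗ₘ eqToHom h') = eqToHom (congrArg₂ (fun x y : PolyCirc S => x ⊗ y) h h') := by
  subst h; subst h'
  exact ofTerm_eq (Rel.tensor_id _ _)

theorem tensorHom_comp {m n p m' n' p' : PolyCirc S} (f : m ⟶ n) (f' : m' ⟶ n') (g : n ⟶ p)
    (g' : n' ⟶ p') : (f ⊗ₘ f') ≫ (g ⊗ₘ g') = (f ≫ g) ⊗ₘ (f' ≫ g') := by
  revert g g'
  refine Quotient.inductionOn₂ f f' fun f f' g g' => Quotient.inductionOn₂ g g' fun g g' => ?_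
  exact (ofTerm_eq (Rel.tensor_comp f g f' g')).symm

theorem tensorObj_assoc (m n p : PolyCirc S) : (m ⊗ n) ⊗ p = m ⊗ (n ⊗ p) :=
  PolyCirc.ext (Nat.add_assoc m.wires n.wires p.wires)

theorem unit_tensorObj (m : PolyCirc S) : 𝟙_ (PolyCirc S) ⊗ m = m :=
  PolyCirc.ext (Nat.zero_add m.wires)

theorem tensorObj_unit (m : PolyCirc S) : m ⊗ 𝟙_ (PolyCirc S) = m :=
  PolyCirc.ext (Nat.add_zero m.wires)

theorem associator_hom (m n p : PolyCirc S) :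
    (α_ m n p).hom = eqToHom (tensorObj_assoc m n p) := rfl

theorem associator_inv (m n p : PolyCirc S) :
    (α_ m n p).inv = eqToHom (tensorObj_assoc m n p).symm := rfl

theorem leftUnitor_hom (m : PolyCirc S) : (λ_ m).hom = eqToHom (unit_tensorObj m) := rfl

theorem leftUnitor_inv (m : PolyCirc S) : (λ_ m).inv = eqToHom (unit_tensorObj m).symm := rfl

theorem rightUnitor_hom (m : PolyCirc S) : (ρ_ m).hom = eqToHom (tensorObj_unit m) := rfl

theorem rightUnitor_inv (m : PolyCirc S) : (ρ_ m).inv = eqToHom (tensorObj_unit m).symm := rfl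

instance : MonoidalCategory (PolyCirc S) :=
  MonoidalCategory.ofTensorHom
    (id_tensorHom_id := fun m n => ofTerm_eq (Rel.tensor_id m.wires n.wires))
    (id_tensorHom := fun _ _ _ _ => rfl)
    (tensorHom_id := fun _ _ => rfl)
    (tensorHom_comp_tensorHom := fun f f' g g' => tensorHom_comp f f' g g')
    (associator_naturality := fun {m m' m'' n n' n''} f g h => by
      rw [associator_hom, associator_hom]
      refine Quotient.inductionOn₃ f g h fun f g h => ?_
      exact (congrArg (_ ≫ ·) (hom_wire _).symm).trans ((ofTerm_eq (Rel.tensor_assoc f g h)).trans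
        (congrArg (· ≫ hom (f.par (g.par h))) (hom_wire _))))
    (leftUnitor_naturality := fun {m n} f => by
      rw [leftUnitor_hom, leftUnitor_hom]
      refine Quotient.inductionOn f fun f => ?_
      exact (congrArg (_ ≫ ·) (hom_wire _).symm).trans
        ((ofTerm_eq (Rel.unit_tensor f)).trans (congrArg (· ≫ hom f) (hom_wire _))))
    (rightUnitor_naturality := fun {m n} f => by
      rw [rightUnitor_hom, rightUnitor_hom]
      refine Quotient.inductionOn f fun f => ?_
      exact (congrArg (_ ≫ ·) (hom_wire _).symm).trans
        ((ofTerm_eq (Rel.tensor_unit f)).trans (congrArg (· ≫ hom f) (hom_wire _))))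
    (pentagon := fun m n p q => by
      rw [← eqToHom_refl q rfl, ← eqToHom_refl m rfl]
      simp only [associator_hom, tensorHom_eqToHom, eqToHom_trans])
    (triangle := fun m n => by
      rw [← eqToHom_refl n rfl, ← eqToHom_refl m rfl]
      simp only [associator_hom, leftUnitor_hom, rightUnitor_hom, tensorHom_eqToHom,
        eqToHom_trans])

theorem hom_seq {m n p : ℕ} (f : Term S m n) (g : Term S n p) :
    hom (f.seq g) = hom f ≫ hom g := rfl

/-- The symmetry of `PolyCirc S`. -/
def twist (m n : PolyCirc S) : m ⊗ n ⟶ n ⊗ m := hom (Term.twist m.wires n.wires)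

/-- The copy map of an object. -/
def copy (n : PolyCirc S) : n ⟶ n ⊗ n := hom (Term.copy n.wires)

/-- The discard map of an object. -/
def discard (n : PolyCirc S) : n ⟶ 𝟙_ (PolyCirc S) := hom (Term.discard n.wires)

/-- The generating morphism of a constant. -/
def const (s : S) : 𝟙_ (PolyCirc S) ⟶ obj S 1 := hom (Term.const s)

theorem twist_twist (m n : PolyCirc S) : twist m n ≫ twist n m = 𝟙 (m ⊗ n) :=
  ofTerm_eq (Rel.twist_twist m.wires n.wires)

theorem twist_natural {m n m' n' : PolyCirc S} (f : m ⟶ n) (g : m' ⟶ n') :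
    (f ⊗ₘ g) ≫ twist n n' = twist m m' ≫ (g ⊗ₘ f) :=
  Quotient.inductionOn₂ f g fun f g => ofTerm_eq (Rel.twist_natural f g)

theorem twist_tensor (m n p : PolyCirc S) :
    twist m (n ⊗ p) = (α_ m n p).inv ≫ twist m n ▷ p ≫ (α_ n m p).hom ≫
      n ◁ twist m p ≫ (α_ n p m).inv := by
  refine Eq.trans (ofTerm_eq (Rel.twist_tensor m.wires n.wires p.wires)) ?_
  change hom _ = _
  simp only [hom_seq, hom_wire]
  rfl

/-- The symmetry as an isomorphism. -/
def twistIso (m n : PolyCirc S) : m ⊗ n ≅ n ⊗ m :=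
  ⟨twist m n, twist n m, twist_twist m n, twist_twist n m⟩

theorem twist_twist_whiskerRight (m n p : PolyCirc S) {q : PolyCirc S} (f : (m ⊗ n) ⊗ p ⟶ q) :
    twist m n ▷ p ≫ twist n m ▷ p ≫ f = f := by
  rw [← comp_whiskerRight_assoc, twist_twist, id_whiskerRight, Category.id_comp]

instance : BraidedCategory (PolyCirc S) where
  braiding := twistIso
  braiding_naturality_right m _ _ f := by
    simpa only [id_tensorHom, tensorHom_id, twistIso] using twist_natural (𝟙 m) f
  braiding_naturality_left f m := by
    simpa only [id_tensorHom, tensorHom_id, twistIso] using twist_natural f (𝟙 m)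
  hexagon_forward m n p := by simp [twistIso, twist_tensor]
  hexagon_reverse m n p := by
    rw [← cancel_mono ((α_ p m n).hom ≫ (twistIso p (m ⊗ n)).hom ≫ (α_ m n p).hom)]
    have h : (twistIso (m ⊗ n) p).hom ≫ (twistIso p (m ⊗ n)).hom = 𝟙 _ := twist_twist _ _
    have h' : (twistIso p (m ⊗ n)).hom = _ := twist_tensor p m n
    have e : m ◁ twist n p ≫ m ◁ twist p n = 𝟙 _ := by
      rw [← whiskerLeft_comp, twist_twist, whiskerLeft_id]
    simp only [Category.assoc, Iso.inv_hom_id_assoc, reassoc_of% h, Iso.inv_hom_id]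
    rw [h']
    simp [twistIso, twist_twist_whiskerRight, e]

/-! Finite products -/

theorem eq_discard {n : PolyCirc S} (f : n ⟶ 𝟙_ (PolyCirc S)) : f = discard n := by
  have h0 : ∀ {m n : PolyCirc S} (f : m ⟶ n), f ≫ discard n = discard m := fun f =>
    Quotient.inductionOn f fun f => ofTerm_eq (Rel.discard_natural f)
  have h1 : discard (𝟙_ (PolyCirc S)) = 𝟙 (𝟙_ (PolyCirc S)) := by
    have h2 : copy (𝟙_ (PolyCirc S)) ≫ discard (𝟙_ _) ▷ 𝟙_ _ ≫ (λ_ _).hom = 𝟙 (𝟙_ _) := by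
      refine Eq.trans ?_ (ofTerm_eq (Rel.copy_discard (S := S) 0))
      change _ = hom _
      simp only [hom_seq, hom_wire]
      rfl
    rw [unitors_equal, rightUnitor_naturality, ← unitors_equal] at h2
    have h3 : copy (𝟙_ (PolyCirc S)) ≫ (λ_ _).hom ≫ discard (𝟙_ _) = discard (𝟙_ _) := by
      rw [h0, h0]
    exact h3.symm.trans h2
  rw [← h0 f, h1, Category.comp_id]

theorem copy_natural {m n : PolyCirc S} (f : m ⟶ n) : f ≫ copy n = copy m ≫ (f ⊗ₘ f) :=
  Quotient.inductionOn f fun f => ofTerm_eq (Rel.copy_natural f)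

theorem copy_comm (n : PolyCirc S) : copy n ≫ twist n n = copy n := ofTerm_eq (Rel.copy_comm n.wires)

theorem copy_fst (n : PolyCirc S) : copy n ≫ discard n ▷ n ≫ (λ_ n).hom = 𝟙 n := by
  refine Eq.trans ?_ (ofTerm_eq (Rel.copy_discard (S := S) n.wires))
  change _ = hom _
  simp only [hom_seq, hom_wire]
  rfl

theorem copy_snd (n : PolyCirc S) : copy n ≫ n ◁ discard n ≫ (ρ_ n).hom = 𝟙 n := by
  have h : (β_ n n).hom = twist n n := rfl
  rw [← copy_fst n]
  conv_rhs => rw [← copy_comm n, ← h]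
  rw [Category.assoc, ← BraidedCategory.braiding_naturality_right_assoc,
    braiding_leftUnitor]

theorem hom_swapMid (m n p q : PolyCirc S) :
    (hom (Term.swapMid m.wires n.wires p.wires q.wires) : (m ⊗ n) ⊗ (p ⊗ q) ⟶ (m ⊗ p) ⊗ (n ⊗ q)) = tensorμ m n p q := by
  have h : ∀ {x y : PolyCirc S} (h : x = y), m ◁ eqToHom h =
      eqToHom (congrArg (fun x => m ⊗ x) h) := fun h => by subst h; simp
  simp only [Term.swapMid, hom_seq, hom_wire, tensorμ, associator_hom, associator_inv, h,
    eqToHom_trans_assoc, eqToHom_trans]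
  rfl

theorem copy_tensor (m n : PolyCirc S) :
    copy (m ⊗ n) = (copy m ⊗ₘ copy n) ≫ tensorμ m m n n := by
  rw [← hom_swapMid]
  exact ofTerm_eq (Rel.copy_tensor m.wires n.wires)

theorem copy_lift_fst {m n p : PolyCirc S} (f : p ⟶ m) (g : p ⟶ n) :
    (copy p ≫ (f ⊗ₘ g)) ≫ m ◁ discard n ≫ (ρ_ m).hom = f := by
  have h : (f ⊗ₘ g) ≫ m ◁ discard n = p ◁ discard p ≫ f ▷ 𝟙_ _ := by
    rw [← id_tensorHom, ← id_tensorHom, ← tensorHom_id, tensorHom_comp_tensorHom,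
      tensorHom_comp_tensorHom, eq_discard (g ≫ discard n)]
    simp
  rw [Category.assoc, reassoc_of% h, rightUnitor_naturality, ← Category.assoc (p ◁ _),
    ← Category.assoc, copy_snd, Category.id_comp]

theorem copy_lift_snd {m n p : PolyCirc S} (f : p ⟶ m) (g : p ⟶ n) :
    (copy p ≫ (f ⊗ₘ g)) ≫ discard m ▷ n ≫ (λ_ n).hom = g := by
  have h : (f ⊗ₘ g) ≫ discard m ▷ n = discard p ▷ p ≫ 𝟙_ _ ◁ g := by
    rw [← id_tensorHom, ← tensorHom_id, ← tensorHom_id, tensorHom_comp_tensorHom,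
      tensorHom_comp_tensorHom, eq_discard (f ≫ discard m)]
    simp
  rw [Category.assoc, reassoc_of% h, leftUnitor_naturality, ← Category.assoc (discard p ▷ _),
    ← Category.assoc, copy_fst, Category.id_comp]

theorem copy_proj (m n : PolyCirc S) :
    copy (m ⊗ n) ≫ ((m ◁ discard n ≫ (ρ_ m).hom) ⊗ₘ (discard m ▷ n ≫ (λ_ n).hom)) =
      𝟙 (m ⊗ n) := by
  have h : tensorμ m (𝟙_ (PolyCirc S)) (𝟙_ _) n ≫ ((ρ_ m).hom ⊗ₘ (λ_ n).hom) =
      (ρ_ m).hom ⊗ₘ (λ_ n).hom := by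
    rw [tensorμ, braiding_tensorUnit_left]
    monoidal
  have h1 := copy_snd m
  have h2 := copy_fst n
  have h3 := tensorμ_natural (𝟙 m) (discard m) (discard n) (𝟙 n)
  simp only [id_tensorHom, tensorHom_id] at h3
  rw [← tensorHom_comp_tensorHom, copy_tensor, Category.assoc, ← reassoc_of% h3, h,
    tensorHom_comp_tensorHom, tensorHom_comp_tensorHom, h1, h2, id_tensorHom_id]

theorem eq_copy_proj {m n p : PolyCirc S} (h : p ⟶ m ⊗ n) :
    h = copy p ≫ ((h ≫ m ◁ discard n ≫ (ρ_ m).hom) ⊗ₘ (h ≫ discard m ▷ n ≫ (λ_ n).hom)) := by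
  rw [← tensorHom_comp_tensorHom, ← Category.assoc, ← copy_natural, Category.assoc, copy_proj,
    Category.comp_id]

instance : CartesianMonoidalCategory (PolyCirc S) where
  isTerminalTensorUnit := Limits.IsTerminal.ofUniqueHom discard fun _ f => eq_discard f
  fst m n := m ◁ discard n ≫ (ρ_ m).hom
  snd m n := discard m ▷ n ≫ (λ_ n).hom
  fst_def _ _ := rfl
  snd_def _ _ := rfl
  tensorProductIsBinaryProduct m n := Limits.BinaryFan.IsLimit.mk _
    (fun f g => copy _ ≫ (f ⊗ₘ g)) copy_lift_fst copy_lift_snd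
    (fun f g h hf hg => by
      subst hf; subst hg
      exact eq_copy_proj h)

theorem lift_eq {m n p : PolyCirc S} (f : p ⟶ m) (g : p ⟶ n) : lift f g = copy p ≫ (f ⊗ₘ g) := rfl

theorem lift_id (n : PolyCirc S) : lift (𝟙 n) (𝟙 n) = copy n := by
  rw [lift_eq, id_tensorHom_id, Category.comp_id]

instance : CartesianDistributiveCategory (PolyCirc S) where
  add n := hom (Term.add n.wires)
  zero n := hom (Term.zero n.wires)
  mul n := hom (Term.mul n.wires)
  one n := hom (Term.one n.wires)
  add_comm n := ofTerm_eq (Rel.add_comm n.wires)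
  add_assoc n := by
    refine (ofTerm_eq (Rel.add_assoc n.wires)).trans ?_
    change hom _ = _
    simp only [hom_seq, hom_wire]
    rfl
  zero_add n := (ofTerm_eq (Rel.zero_add n.wires)).trans (hom_wire _)
  add_tensor m n := by
    rw [← hom_swapMid]
    exact ofTerm_eq (Rel.add_tensor m.wires n.wires)
  zero_tensor m n := (ofTerm_eq (Rel.zero_tensor m.wires n.wires)).trans
    (Category.id_comp (hom (Term.zero m.wires) ⊗ₘ hom (Term.zero n.wires))).symm
  mul_comm n := ofTerm_eq (Rel.mul_comm n.wires)
  mul_assoc n := by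
    refine (ofTerm_eq (Rel.mul_assoc n.wires)).trans ?_
    change hom _ = _
    simp only [hom_seq, hom_wire]
    rfl
  one_mul n := (ofTerm_eq (Rel.one_mul n.wires)).trans (hom_wire _)
  mul_tensor m n := by
    rw [← hom_swapMid]
    exact ofTerm_eq (Rel.mul_tensor m.wires n.wires)
  one_tensor m n := (ofTerm_eq (Rel.one_tensor m.wires n.wires)).trans
    (Category.id_comp (hom (Term.one m.wires) ⊗ₘ hom (Term.one n.wires))).symm
  mul_add n := by
    rw [← hom_swapMid, lift_id]
    exact ofTerm_eq (Rel.mul_add n.wires)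
  mul_zero n := ofTerm_eq (Rel.mul_zero n.wires)

end PolyCirc

/-! A circuit acts on the points `Fin n → K` of every commutative `S`-algebra `K`, and this action
determines it. Soundness (`Rel.eval_eq`) is a check of the relations. For completeness (`ext_ev`),
the circuits `A ⟶ obj S 1` themselves form a commutative `S`-algebra `Fun A`; evaluating a circuit
there at the generic point, the coordinates of `𝟙 A`, returns the coordinates of the circuit
(`coords_comp_hom`). So an equation of circuits may be checked on points. Conversely every tuple of
polynomials over `S` is realised by a circuit, uniformly in `K` (`exists_ev_eq_aeval_tuple`).

The directional derivative `tangent f x a` is the infinitesimal part of `f` evaluated over the dual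
numbers at `x + εa`, so the chain rule and the derivatives of structure maps follow from
functoriality of evaluation. The transposed Jacobian applied to `d` is polynomial in `(x, d)`, hence
denoted by a circuit `reverse f`, and it satisfies `⟨R[f](x, d), a⟩ = ⟨d, tangent f x a⟩`
(`reverse_dotProduct`). The dot product is nondegenerate over every commutative semiring, so this
adjunction characterises `reverse f` (`reverse_eq`). The structural axioms thus become identities
between tangents, those with target `𝟙_` being clear by terminality. The remaining axioms hold
because `R[f]` is linear in `d`, the forward derivative of `R` is `tangent`, and second partial
derivatives commute. -/

namespace PolyCirc

/-! ### Evaluation of circuits in commutative algebras -/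

section Evaluation

variable {S : Type u} [CommSemiring S] {K : Type u} [CommSemiring K] [Algebra S K]

/-- Concatenation of two tuples, by comparison of indices. -/
def join {m n : ℕ} (x : Fin m → K) (y : Fin n → K) : Fin (m + n) → K := fun i =>
  if h : i.1 < m then x ⟨i.1, h⟩ else y ⟨i.1 - m, by omega⟩

variable (K) in
/-- The polynomial map denoted by a term. -/
def Term.eval : ∀ {m n : ℕ}, Term S m n → (Fin m → K) → Fin n → K
  | _, _, .ident _, x => x
  | _, _, .seq f g, x => g.eval (f.eval x)
  | _, _, .par (m := m) (m' := m') f g, x =>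
      join (f.eval fun i => x ⟨i.1, by omega⟩) (g.eval fun i => x ⟨m + i.1, by omega⟩)
  | _, _, .twist m n, x => join (fun i => x ⟨m + i.1, by omega⟩) (fun i => x ⟨i.1, by omega⟩)
  | _, _, .copy _, x => join x x
  | _, _, .discard _, _ => fun i => i.elim0
  | _, _, .add n, x => fun i => x ⟨i.1, by omega⟩ + x ⟨n + i.1, by omega⟩
  | _, _, .zero _, _ => fun _ => 0
  | _, _, .mul n, x => fun i => x ⟨i.1, by omega⟩ * x ⟨n + i.1, by omega⟩
  | _, _, .one _, _ => fun _ => 1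
  | _, _, .const s, _ => fun _ => algebraMap S K s

theorem Term.eval_wire {m n : ℕ} (h : m = n) (x : Fin m → K) :
    (Term.wire h : Term S m n).eval K x = fun i => x ⟨i.1, by omega⟩ := by
  subst h; rfl

theorem Term.eval_swapMid (m n p q : ℕ) (x : Fin ((m + n) + (p + q)) → K) :
    (Term.swapMid m n p q : Term S _ _).eval K x =
      join (join (fun i => x ⟨i.1, by omega⟩) (fun i => x ⟨m + n + i.1, by omega⟩))
        (join (fun i => x ⟨m + i.1, by omega⟩) (fun i => x ⟨m + n + p + i.1, by omega⟩)) := by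
  funext i
  simp only [Term.swapMid, Term.eval, Term.eval_wire, join]
  split_ifs <;> first | omega | rfl | (congr 2; omega)

theorem eval_fin_congr {m n : ℕ} (t : Term S m n) {x y : Fin m → K} {i j : Fin n}
    (h : ∀ k, x k = y k) (hij : i.1 = j.1) : t.eval K x i = t.eval K y j := by
  rw [funext h, Fin.ext hij]

/-- Extending a tuple by zero to all of `ℕ` removes the bound proofs from its indices, so that
equations between reindexed tuples become arithmetic of natural numbers. -/
theorem exists_nat_extension {n : ℕ} (x : Fin n → K) : ∃ y : ℕ → K, x = fun i => y i.1 :=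
  ⟨fun i => if h : i < n then x ⟨i, h⟩ else 0, by simp⟩

/-- Soundness: each generating relation holds for tuples over a commutative semiring. The structural
ones are bookkeeping of indices, the others are semiring laws or say that `algebraMap S K` is a ring
homomorphism. -/
theorem Rel.eval_eq {m n : ℕ} {t t' : Term S m n} (h : Rel t t') : t.eval K = t'.eval K := by
  induction h with
  | refl => rfl
  | symm _ ih => exact ih.symm
  | trans _ _ ih ih' => exact ih.trans ih'
  | comp_congr _ _ ih ih' => funext x; simp only [Term.eval, ih, ih']
  | tensor_congr _ _ ih ih' => funext x; simp only [Term.eval, ih, ih']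
  | id_comp => rfl
  | comp_id => rfl
  | comp_assoc => rfl
  | tensor_comp f g f' g' =>
    funext x i
    simp only [Term.eval, join]
    split_ifs <;> refine eval_fin_congr _ (fun k => ?_) rfl
    · rw [dif_pos k.2]
    · rw [dif_neg (by omega)]
      exact eval_fin_congr _ (fun _ => rfl) (by simp)
  | tensor_assoc | unit_tensor | tensor_unit =>
    funext x i
    simp only [Term.eval, Term.eval_wire, join]
    split_ifs <;> first
      | omega
      | exact eval_fin_congr _ (fun k => congrArg x (Fin.ext (by simp; try omega)))
          (by simp; try omega)
  | twist_natural f g =>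
    funext x i
    simp only [Term.eval, join]
    split_ifs <;> first
      | omega
      | (refine eval_fin_congr _ (fun k => ?_) (by simp; try omega)
         split_ifs <;> first
           | omega
           | exact congrArg x (Fin.ext (by simp; try omega)))
  | copy_natural f =>
    funext x i
    simp only [Term.eval, join, Fin.is_lt, dite_true, Nat.add_sub_cancel_left, Nat.not_lt.2,
      Nat.le_add_right, dite_false, Fin.eta]
  | discard_natural f => rfl
  | mul_add n =>
    funext x i
    obtain ⟨y, rfl⟩ : ∃ y : ℕ → K, x = fun i => y i.1 := exists_nat_extension x
    have hi := i.2
    have hi' : i.1 < n + n := by omega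
    simp only [Term.eval, Term.eval_swapMid, join, dite_eq_ite]
    simp [hi, hi', Nat.add_assoc, Nat.add_sub_add_left, _root_.mul_add]
  | _ =>
    funext x i
    obtain ⟨y, rfl⟩ : ∃ y : ℕ → K, x = fun i => y i.1 := exists_nat_extension x
    have hi := i.2
    simp only [Term.eval, Term.eval_wire, Term.eval_swapMid, join, dite_eq_ite, map_zero,
      map_one, map_add, map_mul]
    first
      | done
      | grind
      | (simp [hi, Nat.add_assoc]; try ring)

end Evaluation
variable {S : Type u} [CommSemiring S]

/-! ### Points of objects and the maps that circuits induce on them. -/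

section Points

variable {K : Type u} {A B A' B' Z : PolyCirc S}

variable (K) in
/-- The `K`-points of an object. -/
abbrev Pt (A : PolyCirc S) : Type u := Fin A.wires → K

/-- The point of a product with given components. -/
def pair (x : Pt K A) (y : Pt K B) : Pt K (A ⊗ B) := join x y

/-- The first component of a point of a product. -/
def Pt.left (z : Pt K (A ⊗ B)) : Pt K A := fun i => z ⟨i.1, Nat.lt_add_right _ i.2⟩

/-- The second component of a point of a product. -/
def Pt.right (z : Pt K (A ⊗ B)) : Pt K B := fun i => z ⟨A.wires + i.1, Nat.add_lt_add_left i.2 _⟩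

theorem left_pair (x : Pt K A) (y : Pt K B) : Pt.left (pair x y) = x := by
  funext i
  simp [Pt.left, pair, join]

theorem right_pair (x : Pt K A) (y : Pt K B) : Pt.right (pair x y) = y := by
  funext i
  simp [Pt.right, pair, join]

theorem pair_left_right (z : Pt K (A ⊗ B)) : pair (Pt.left z) (Pt.right z) = z := by
  funext i
  simp only [pair, join, Pt.left, Pt.right]
  split_ifs with h
  · rfl
  · exact congrArg z (Fin.ext (Nat.add_sub_cancel' (not_lt.1 h)))

theorem exists_eq_pair (z : Pt K (A ⊗ B)) : ∃ x y, z = pair x y :=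
  ⟨_, _, (pair_left_right z).symm⟩

variable [CommSemiring K] [Algebra S K]

variable (K) in
/-- The map on `K`-points denoted by a circuit. -/
def ev (f : A ⟶ B) : Pt K A → Pt K B :=
  Quotient.lift (fun t : Term S A.wires B.wires => t.eval K) (fun _ _ h => Rel.eval_eq h) f

@[simp] theorem ev_id (x : Pt K A) : ev K (𝟙 A) x = x := rfl

@[simp] theorem ev_comp (f : A ⟶ B) (g : B ⟶ Z) (x : Pt K A) :
    ev K (f ≫ g) x = ev K g (ev K f x) :=
  Quotient.inductionOn₂ f g fun _ _ => rfl

@[simp] theorem ev_tensorHom (f : A ⟶ A') (g : B ⟶ B') (x : Pt K A) (y : Pt K B) :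
    ev K (f ⊗ₘ g) (pair x y) = pair (ev K f x) (ev K g y) := by
  refine Quotient.inductionOn₂ f g fun f g => ?_
  change (Term.par f g).eval K _ = join (f.eval K x) (g.eval K y)
  exact congrArg₂ (fun x y => join (f.eval K x) (g.eval K y)) (left_pair x y) (right_pair x y)

theorem ev_eqToHom (h : A = B) (x : Pt K A) :
    ev K (eqToHom h) x = fun i => x ⟨i.1, by rw [h]; exact i.2⟩ := by
  subst h; rfl

@[simp] theorem ev_fst (x : Pt K A) (y : Pt K B) : ev K (fst A B) (pair x y) = x := by
  -- By definition the projection discards one factor and then applies a unitor, which in this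
  -- strict category is an `eqToHom` and only relabels indices.
  change ev K ((𝟙 A ⊗ₘ discard B) ≫ eqToHom (tensorObj_unit A)) _ = _
  rw [ev_comp, ev_tensorHom, ev_eqToHom]
  exact left_pair _ _

@[simp] theorem ev_snd (x : Pt K A) (y : Pt K B) : ev K (snd A B) (pair x y) = y := by
  change ev K ((discard A ⊗ₘ 𝟙 B) ≫ eqToHom (unit_tensorObj B)) _ = _
  rw [ev_comp, ev_tensorHom, ev_eqToHom, ev_id]
  have h : ∀ i : Fin B.wires, i.1 - (𝟙_ (PolyCirc S)).wires = i.1 := fun i => Nat.sub_zero _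
  have h' : ∀ i : Fin B.wires, ¬ i.1 < (𝟙_ (PolyCirc S)).wires := fun i => Nat.not_lt_zero _
  funext i
  simp [pair, join, h, h']

@[simp] theorem ev_lift (f : Z ⟶ A) (g : Z ⟶ B) (x : Pt K Z) :
    ev K (lift f g) x = pair (ev K f x) (ev K g x) := by
  obtain ⟨y, z, h⟩ := exists_eq_pair (ev K (lift f g) x)
  have h1 := congrArg (ev K (fst A B)) h
  have h2 := congrArg (ev K (snd A B)) h
  rw [← ev_comp, lift_fst, ev_fst] at h1
  rw [← ev_comp, lift_snd, ev_snd] at h2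
  rw [h, h1, h2]

@[simp] theorem ev_whiskerLeft (f : B ⟶ B') (x : Pt K A) (y : Pt K B) :
    ev K (A ◁ f) (pair x y) = pair x (ev K f y) := by
  rw [← id_tensorHom, ev_tensorHom, ev_id]

@[simp] theorem ev_whiskerRight (f : A ⟶ A') (x : Pt K A) (y : Pt K B) :
    ev K (f ▷ B) (pair x y) = pair (ev K f x) y := by
  rw [← tensorHom_id, ev_tensorHom, ev_id]

@[simp] theorem ev_associator_hom (x : Pt K A) (y : Pt K B) (z : Pt K Z) :
    ev K (α_ A B Z).hom (pair (pair x y) z) = pair x (pair y z) := by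
  have : (α_ A B Z).hom = lift (fst _ _ ≫ fst _ _) (lift (fst _ _ ≫ snd _ _) (snd _ _)) := by
    ext <;> simp
  simp [this]

@[simp] theorem ev_associator_inv (x : Pt K A) (y : Pt K B) (z : Pt K Z) :
    ev K (α_ A B Z).inv (pair x (pair y z)) = pair (pair x y) z := by
  rw [← ev_associator_hom, ← ev_comp, Iso.hom_inv_id, ev_id]

@[simp] theorem ev_leftUnitor_hom (u : Pt K (𝟙_ (PolyCirc S))) (x : Pt K A) :
    ev K (λ_ A).hom (pair u x) = x := by
  rw [CartesianMonoidalCategory.leftUnitor_hom, ev_snd]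

@[simp] theorem ev_rightUnitor_hom (u : Pt K (𝟙_ (PolyCirc S))) (x : Pt K A) :
    ev K (ρ_ A).hom (pair x u) = x := by
  rw [CartesianMonoidalCategory.rightUnitor_hom, ev_fst]

/-- The unit object has exactly one point, so any `u` may be inserted; it has to be supplied because
the left-hand side does not determine it. -/
theorem ev_leftUnitor_inv (u : Pt K (𝟙_ (PolyCirc S))) (x : Pt K A) :
    ev K (λ_ A).inv x = pair u x := by
  conv_lhs => rw [← ev_leftUnitor_hom u x, ← ev_comp, Iso.hom_inv_id, ev_id]

theorem ev_rightUnitor_inv (u : Pt K (𝟙_ (PolyCirc S))) (x : Pt K A) :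
    ev K (ρ_ A).inv x = pair x u := by
  conv_lhs => rw [← ev_rightUnitor_hom u x, ← ev_comp, Iso.hom_inv_id, ev_id]

@[simp] theorem ev_braiding (x : Pt K A) (y : Pt K B) :
    ev K (β_ A B).hom (pair x y) = pair y x := by
  simp [← lift_snd_fst]

@[simp] theorem ev_tensorμ (x : Pt K A) (y : Pt K B) (x' : Pt K A') (y' : Pt K B') :
    ev K (tensorμ A B A' B') (pair (pair x y) (pair x' y')) = pair (pair x x') (pair y y') := by
  simp [tensorμ]

open CartesianLeftAdditiveCategory CartesianDistributiveCategory

@[simp] theorem ev_add (x y : Pt K A) : ev K (add A) (pair x y) = x + y := by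
  exact congrArg₂ (· + ·) (left_pair x y) (right_pair x y)

@[simp] theorem ev_mul (x y : Pt K A) : ev K (mul A) (pair x y) = x * y := by
  exact congrArg₂ (· * ·) (left_pair x y) (right_pair x y)

@[simp] theorem ev_zero (u : Pt K (𝟙_ (PolyCirc S))) : ev K (zero A) u = 0 := rfl

theorem ev_const (s : S) (u : Pt K (𝟙_ (PolyCirc S))) :
    ev K (const s) u = fun _ => algebraMap S K s := rfl

/-- Evaluation commutes with homomorphisms of algebras. -/
theorem Term.map_eval {L : Type u} [CommSemiring L] [Algebra S L] (φ : K →ₐ[S] L) {m n : ℕ}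
    (t : Term S m n) (x : Fin m → K) (i : Fin n) :
    φ (t.eval K x i) = t.eval L (fun k => φ (x k)) i := by
  induction t with
  | ident | add | zero | mul | one => simp [Term.eval]
  | const s => simp [Term.eval]
  | discard => exact i.elim0
  | copy | twist =>
    simp only [Term.eval, join]
    split_ifs <;> rfl
  | seq f g ihf ihg => simp only [Term.eval, ihg, ihf]
  | par f g ihf ihg =>
    simp only [Term.eval, join]
    split_ifs
    · rw [ihf]
    · rw [ihg]

theorem map_ev {L : Type u} [CommSemiring L] [Algebra S L] (φ : K →ₐ[S] L) (f : A ⟶ B)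
    (x : Pt K A) (i : Fin B.wires) : φ (ev K f x i) = ev L f (fun k => φ (x k)) i :=
  Quotient.inductionOn f fun t => Term.map_eval φ t x i

end Points

/-! ### Completeness of evaluation -/

section Completeness

open CartesianLeftAdditiveCategory CartesianDistributiveCategory

/-- The projections of an object onto its wires. -/
def proj : ∀ n : ℕ, Fin n → (obj S n ⟶ obj S 1)
  | 0, i => i.elim0
  | n + 1, i => Fin.lastCases (motive := fun _ => obj S (n + 1) ⟶ obj S 1)
      (snd (obj S n) (obj S 1)) (fun i => fst (obj S n) (obj S 1) ≫ proj n i) i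

theorem proj_last (n : ℕ) : proj (S := S) (n + 1) (Fin.last n) = snd (obj S n) (obj S 1) := by
  simp [proj]

theorem proj_castSucc (n : ℕ) (i : Fin n) :
    proj (S := S) (n + 1) i.castSucc = fst (obj S n) (obj S 1) ≫ proj n i := by
  simp [proj]

/-- The object `n + 1` is definitionally `n ⊗ 1`, so joint monicity of the wire projections follows
by induction from that of `fst` and `snd`. -/
theorem hom_ext_proj {A : PolyCirc S} : ∀ {n : ℕ} {f g : A ⟶ obj S n},
    (∀ i, f ≫ proj n i = g ≫ proj n i) → f = g
  | 0, _, _, _ => toUnit_unique _ _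
  | n + 1, f, g, h => by
    refine CartesianMonoidalCategory.hom_ext (X := obj S n) (Y := obj S 1) f g
      (hom_ext_proj fun i => ?_) ?_
    · have := h i.castSucc
      rw [proj_castSucc] at this
      simpa only [Category.assoc] using this
    · have := h (Fin.last n)
      rwa [proj_last] at this

theorem proj_one (i : Fin 1) : proj (S := S) 1 i = 𝟙 (obj S 1) := by
  obtain rfl : i = Fin.last 0 := Subsingleton.elim _ _
  rw [proj_last]
  exact (CartesianMonoidalCategory.leftUnitor_hom (obj S 1)).symm

theorem fst_proj (m p : ℕ) (i : Fin m) :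
    fst (obj S m) (obj S p) ≫ proj m i = proj (m + p) (Fin.castAdd p i) := by
  induction p with
  | zero =>
    have : fst (obj S m) (obj S 0) = 𝟙 _ :=
      (CartesianMonoidalCategory.rightUnitor_hom (obj S m)).symm
    rw [this]
    exact Category.id_comp _
  | succ p ih =>
    -- Here `m + (p + 1)` and `(m + p) + 1` agree definitionally, so the associator is the identity
    -- and its projection rules split off the last wire.
    have h : (α_ (obj S m) (obj S p) (obj S 1)).hom = 𝟙 _ := rfl
    have h' := associator_hom_fst (obj S m) (obj S p) (obj S 1)
    rw [h] at h'
    have h'' : fst (obj S m) (obj S (p + 1)) =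
      fst (obj S (m + p)) (obj S 1) ≫ fst (obj S m) (obj S p) := by
      refine Eq.trans ?_ h'
      exact (Category.id_comp _).symm
    rw [h'', Category.assoc, ih]
    exact (proj_castSucc (m + p) (Fin.castAdd p i)).symm

theorem snd_proj (m p : ℕ) (i : Fin p) :
    snd (obj S m) (obj S p) ≫ proj p i = proj (m + p) (Fin.natAdd m i) := by
  induction p with
  | zero => exact i.elim0
  | succ p ih =>
    have h : (α_ (obj S m) (obj S p) (obj S 1)).hom = 𝟙 _ := rfl
    refine Fin.lastCases ?_ (fun i => ?_) i
    · rw [proj_last]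
      have h' := associator_hom_snd_snd (obj S m) (obj S p) (obj S 1)
      rw [h] at h'
      refine (Category.id_comp _).symm.trans (h'.trans ?_)
      exact (proj_last (m + p)).symm
    · rw [proj_castSucc]
      have h' := associator_hom_snd_fst (obj S m) (obj S p) (obj S 1)
      rw [h] at h'
      have h'' : snd (obj S m) (obj S (p + 1)) ≫ fst (obj S p) (obj S 1) =
        fst (obj S (m + p)) (obj S 1) ≫ snd (obj S m) (obj S p) := by
        refine Eq.trans ?_ h'
        exact (Category.id_comp _).symm
      rw [reassoc_of% h'', ih]
      exact (proj_castSucc (m + p) (Fin.natAdd m i)).symm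

/-- Compatibility with tensor products forces an operation to act wire by wire. The family `op` is
left abstract so that one induction serves both addition and multiplication. -/
theorem binary_proj (op : ∀ A : PolyCirc S, A ⊗ A ⟶ A)
    (h : ∀ A B, op (A ⊗ B) = tensorμ A B A B ≫ (op A ⊗ₘ op B)) (n : ℕ) (i : Fin n) :
    op (obj S n) ≫ proj n i = (proj n i ⊗ₘ proj n i) ≫ op (obj S 1) := by
  induction n with
  | zero => exact i.elim0
  | succ n ih =>
    have h' : op (obj S (n + 1)) = _ := h (obj S n) (obj S 1)
    refine Fin.lastCases ?_ (fun i => ?_) i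
    · rw [proj_last, h']
      simp only [Category.assoc, tensorHom_snd, tensorμ_snd_assoc]
    · rw [proj_castSucc, h']
      simp only [Category.assoc, tensorHom_fst_assoc, tensorμ_fst_assoc, ih,
        tensorHom_comp_tensorHom_assoc]

theorem nullary_proj (op : ∀ A : PolyCirc S, 𝟙_ (PolyCirc S) ⟶ A)
    (h : ∀ A B, op (A ⊗ B) = (λ_ (𝟙_ (PolyCirc S))).inv ≫ (op A ⊗ₘ op B)) (n : ℕ) (i : Fin n) :
    op (obj S n) ≫ proj n i = op (obj S 1) := by
  induction n with
  | zero => exact i.elim0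
  | succ n ih =>
    have h' : op (obj S (n + 1)) = _ := h (obj S n) (obj S 1)
    refine Fin.lastCases ?_ (fun i => ?_) i
    · rw [proj_last, h']
      simp
    · rw [proj_castSucc, h']
      have : (λ_ (𝟙_ (PolyCirc S))).inv ≫ fst (𝟙_ (PolyCirc S)) (𝟙_ (PolyCirc S)) = 𝟙 _ :=
        toUnit_unique _ _
      simp only [Category.assoc, tensorHom_fst_assoc, ih]
      rw [reassoc_of% this]

/-- The functions on an object, that is, the circuits with one output. -/
def Fun (A : PolyCirc S) : Type u := A ⟶ obj S 1

/-! ### The commutative `S`-algebra of circuits with one output. -/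

namespace Fun

variable {A : PolyCirc S}

instance : Add (Fun A) := ⟨fun f g => lift f g ≫ add (obj S 1)⟩
instance : Mul (Fun A) := ⟨fun f g => lift f g ≫ mul (obj S 1)⟩
instance : Zero (Fun A) := ⟨toUnit A ≫ zero (obj S 1)⟩
instance : One (Fun A) := ⟨toUnit A ≫ one (obj S 1)⟩

variable (f g h : A ⟶ obj S 1)

/-- This law, like those that follow, is the axiom for the object `1` precomposed with the tuple of
its arguments. -/
protected theorem add_comm : lift f g ≫ add (obj S 1) = lift g f ≫ add (obj S 1) := by
  rw [← CartesianLeftAdditiveCategory.add_comm, ← Category.assoc, lift_braiding_hom,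
    CartesianLeftAdditiveCategory.add_comm]

protected theorem mul_comm : lift f g ≫ mul (obj S 1) = lift g f ≫ mul (obj S 1) := by
  rw [← CartesianDistributiveCategory.mul_comm, ← Category.assoc, lift_braiding_hom,
    CartesianDistributiveCategory.mul_comm]

protected theorem zero_add : lift (toUnit A ≫ zero (obj S 1)) f ≫ add (obj S 1) = f := by
  have h := congrArg (lift (toUnit A) f ≫ ·) (CartesianLeftAdditiveCategory.zero_add (obj S 1))
  simpa only [← Category.assoc, lift_whiskerRight, lift_leftUnitor_hom] using h

protected theorem one_mul : lift (toUnit A ≫ one (obj S 1)) f ≫ mul (obj S 1) = f := by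
  have h := congrArg (lift (toUnit A) f ≫ ·) (CartesianDistributiveCategory.one_mul (obj S 1))
  simpa only [← Category.assoc, lift_whiskerRight, lift_leftUnitor_hom] using h

protected theorem add_assoc : lift (lift f g ≫ add (obj S 1)) h ≫ add (obj S 1) =
    lift f (lift g h ≫ add (obj S 1)) ≫ add (obj S 1) := by
  have e := congrArg (lift (lift f g) h ≫ ·)
    (CartesianLeftAdditiveCategory.add_assoc (obj S 1))
  simpa only [← Category.assoc, lift_whiskerRight, lift_lift_associator_hom, lift_whiskerLeft]
    using e

protected theorem mul_assoc : lift (lift f g ≫ mul (obj S 1)) h ≫ mul (obj S 1) =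
    lift f (lift g h ≫ mul (obj S 1)) ≫ mul (obj S 1) := by
  have e := congrArg (lift (lift f g) h ≫ ·)
    (CartesianDistributiveCategory.mul_assoc (obj S 1))
  simpa only [← Category.assoc, lift_whiskerRight, lift_lift_associator_hom, lift_whiskerLeft]
    using e

protected theorem mul_add : lift f (lift g h ≫ add (obj S 1)) ≫ mul (obj S 1) =
    lift (lift f g ≫ mul (obj S 1)) (lift f h ≫ mul (obj S 1)) ≫ add (obj S 1) := by
  have e := congrArg (lift f (lift g h) ≫ ·)
    (CartesianDistributiveCategory.mul_add (obj S 1))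
  have e' : lift (lift f f) (lift g h) ≫ tensorμ (obj S 1) (obj S 1) (obj S 1) (obj S 1) =
      lift (lift f g) (lift f h) := by
    apply CartesianMonoidalCategory.hom_ext
    · rw [Category.assoc, tensorμ_fst, lift_map, lift_fst, lift_fst, lift_fst]
    · rw [Category.assoc, tensorμ_snd, lift_map, lift_snd, lift_snd, lift_snd]
  simpa only [← Category.assoc, lift_whiskerRight, lift_whiskerLeft, comp_lift, Category.comp_id,
    e', lift_map] using e

protected theorem mul_zero : lift f (toUnit A ≫ zero (obj S 1)) ≫ mul (obj S 1) =
    toUnit A ≫ zero (obj S 1) := by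
  have e := congrArg (lift f (toUnit A) ≫ ·)
    (CartesianDistributiveCategory.mul_zero (obj S 1))
  simpa only [← Category.assoc, lift_whiskerLeft, comp_toUnit] using e

instance : CommSemiring (Fun A) where
  add_assoc f g h := Fun.add_assoc f g h
  zero_add f := Fun.zero_add f
  add_zero f := (Fun.add_comm f _).trans (Fun.zero_add f)
  add_comm f g := Fun.add_comm f g
  mul_assoc f g h := Fun.mul_assoc f g h
  one_mul f := Fun.one_mul f
  mul_one f := (Fun.mul_comm f _).trans (Fun.one_mul f)
  mul_comm f g := Fun.mul_comm f g
  left_distrib f g h := Fun.mul_add f g h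
  right_distrib f g h := (Fun.mul_comm _ h).trans ((Fun.mul_add h f g).trans
    (congrArg₂ (fun a b : Fun A => a + b) (Fun.mul_comm h f) (Fun.mul_comm h g)))
  mul_zero f := Fun.mul_zero f
  zero_mul f := (Fun.mul_comm _ f).trans (Fun.mul_zero f)
  nsmul := nsmulRec

theorem lift_const_comp (s t : S) (op : obj S 1 ⊗ obj S 1 ⟶ obj S 1) :
    lift (toUnit A ≫ const s) (toUnit A ≫ const t) ≫ op =
      toUnit A ≫ (λ_ (𝟙_ (PolyCirc S))).inv ≫ (const s ⊗ₘ const t) ≫ op := by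
  rw [← lift_map, Category.assoc, ← Category.assoc (toUnit A) (λ_ _).inv]
  congr 1
  ext

theorem const_zero : const (0 : S) = zero (obj S 1) := ofTerm_eq Rel.const_zero

theorem const_one : const (1 : S) = one (obj S 1) := ofTerm_eq Rel.const_one

theorem const_add (s t : S) :
    (λ_ (𝟙_ (PolyCirc S))).inv ≫ (const s ⊗ₘ const t) ≫ add (obj S 1) = const (s + t) :=
  (Category.id_comp _).trans (ofTerm_eq (Rel.const_add s t))

theorem const_mul (s t : S) :
    (λ_ (𝟙_ (PolyCirc S))).inv ≫ (const s ⊗ₘ const t) ≫ mul (obj S 1) = const (s * t) :=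
  (Category.id_comp _).trans (ofTerm_eq (Rel.const_mul s t))

/-- The constant functions. -/
def constHom : S →+* Fun A where
  toFun s := toUnit A ≫ const s
  map_zero' := by rw [const_zero]; rfl
  map_one' := by rw [const_one]; rfl
  map_add' s t := by
    rw [← const_add, ← lift_const_comp]; rfl
  map_mul' s t := by
    rw [← const_mul, ← lift_const_comp]; rfl

instance : Algebra S (Fun A) := constHom.toAlgebra

end Fun

/-! ### Generalized points and faithfulness of evaluation. -/

/-- The coordinates of a generalized point. -/
def coords {A : PolyCirc S} {n : ℕ} (x : A ⟶ obj S n) : Fin n → Fun A := fun i => x ≫ proj n i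

theorem coords_join {A : PolyCirc S} {m n : ℕ} (x : A ⟶ obj S m) (y : A ⟶ obj S n) :
    coords (n := m + n) (lift x y) = join (coords x) (coords y) := by
  funext i
  refine Fin.addCases (fun i => ?_) (fun i => ?_) i
  · have h := congrArg (lift x y ≫ ·) (fst_proj (S := S) m n i)
    simp only [← Category.assoc, lift_fst] at h
    have h' : join (coords x) (coords y) (Fin.castAdd n i) = coords x i := by simp [join]
    rw [h']
    exact h.symm
  · have h := congrArg (lift x y ≫ ·) (snd_proj (S := S) m n i)
    simp only [← Category.assoc, lift_snd] at h
    have h' : join (coords x) (coords y) (Fin.natAdd m i) = coords y i := by simp [join]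
    rw [h']
    exact h.symm

theorem coords_comp_fst {A : PolyCirc S} {m n : ℕ} (x : A ⟶ obj S m ⊗ obj S n) :
    coords (x ≫ fst (obj S m) (obj S n)) =
      fun i => coords (n := m + n) x ⟨i.1, Nat.lt_add_right _ i.2⟩ := by
  funext i
  exact (Category.assoc _ _ _).trans (congrArg (x ≫ ·) (fst_proj (S := S) m n i))

theorem coords_comp_snd {A : PolyCirc S} {m n : ℕ} (x : A ⟶ obj S m ⊗ obj S n) :
    coords (x ≫ snd (obj S m) (obj S n)) =
      fun i => coords (n := m + n) x ⟨m + i.1, Nat.add_lt_add_left i.2 _⟩ := by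
  funext i
  exact (Category.assoc _ _ _).trans (congrArg (x ≫ ·) (snd_proj (S := S) m n i))

theorem coords_comp_binary (op : ∀ A : PolyCirc S, A ⊗ A ⟶ A)
    (h : ∀ A B, op (A ⊗ B) = tensorμ A B A B ≫ (op A ⊗ₘ op B)) {A : PolyCirc S} {n : ℕ}
    (x : A ⟶ obj S n ⊗ obj S n) (i : Fin n) :
    coords (x ≫ op (obj S n)) i =
      lift (coords (n := n + n) x ⟨i.1, Nat.lt_add_right _ i.2⟩)
        (coords (n := n + n) x ⟨n + i.1, Nat.add_lt_add_left i.2 _⟩) ≫ op (obj S 1) := by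
  have h1 := congrFun (coords_comp_fst x) i
  have h2 := congrFun (coords_comp_snd x) i
  rw [← h1, ← h2]
  change (x ≫ op (obj S n)) ≫ proj n i =
    lift ((x ≫ fst _ _) ≫ proj n i) ((x ≫ snd _ _) ≫ proj n i) ≫ _
  rw [Category.assoc, binary_proj op h, ← lift_map, ← comp_lift, lift_fst_snd, Category.comp_id,
    Category.assoc]

/-- Composing with a circuit is the same as evaluating it in the algebra `Fun A`. By induction on
the term: `join` matches pairing, and `binary_proj` and `nullary_proj` reduce the operations on `n`
wires to those on one wire, which define the algebra. -/
theorem coords_comp_hom {A : PolyCirc S} {m n : ℕ} (t : Term S m n) (x : A ⟶ obj S m) :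
    coords (x ≫ hom t) = t.eval (Fun A) (coords x) := by
  induction t with
  | ident n => exact congrArg coords (Category.comp_id x)
  | seq f g ihf ihg => rw [hom_seq, ← Category.assoc, ihg, ihf]; rfl
  | par f g ihf ihg =>
    rw [Term.eval]
    erw [← coords_comp_fst x, ← coords_comp_snd x]
    rw [← ihf, ← ihg, ← coords_join]
    refine congrArg coords ?_
    change x ≫ (hom f ⊗ₘ hom g) = _
    apply CartesianMonoidalCategory.hom_ext <;> simp
  | twist m n =>
    rw [Term.eval]
    erw [← coords_comp_fst x, ← coords_comp_snd x]
    rw [← coords_join]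
    refine congrArg coords ?_
    change x ≫ (β_ (obj S m) (obj S n)).hom = _
    apply CartesianMonoidalCategory.hom_ext <;> simp
  | copy n =>
    rw [Term.eval, ← coords_join]
    refine congrArg coords ?_
    change x ≫ copy (obj S n) = _
    rw [← lift_id, comp_lift, Category.comp_id]
  | discard n => exact funext fun i => i.elim0
  | add n =>
    funext i
    exact coords_comp_binary add add_tensor x i
  | mul n =>
    funext i
    exact coords_comp_binary mul mul_tensor x i
  | zero n =>
    funext i
    change (x ≫ zero (obj S n)) ≫ proj n i = toUnit A ≫ zero (obj S 1)
    rw [Category.assoc, nullary_proj zero zero_tensor]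
    exact congrArg (· ≫ zero (obj S 1)) (toUnit_unique _ _)
  | one n =>
    funext i
    change (x ≫ one (obj S n)) ≫ proj n i = toUnit A ≫ one (obj S 1)
    rw [Category.assoc, nullary_proj one one_tensor]
    exact congrArg (· ≫ one (obj S 1)) (toUnit_unique _ _)
  | const s =>
    funext i
    change (x ≫ const s) ≫ proj 1 i = toUnit A ≫ const s
    rw [proj_one, Category.comp_id]
    exact congrArg (· ≫ const s) (toUnit_unique _ _)

/-- Circuits that denote the same maps on points are equal. -/
theorem ext_ev {A B : PolyCirc S} {f g : A ⟶ B}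
    (h : ∀ (K : Type u) [CommSemiring K] [Algebra S K] (x : Pt K A), ev K f x = ev K g x) :
    f = g := by
  revert h
  refine Quotient.inductionOn₂ f g fun t t' h => hom_ext_proj fun i => ?_
  -- The generic point: evaluation in `Fun A` at the coordinates of the identity recovers the
  -- coordinates of the circuit.
  have e := coords_comp_hom t (𝟙 A)
  have e' := coords_comp_hom t' (𝟙 A)
  rw [show t.eval (Fun A) = t'.eval (Fun A) from funext (h (Fun A)), ← e'] at e
  rw [Category.id_comp, Category.id_comp] at e
  exact congrFun e i

theorem ev_proj {K : Type u} [CommSemiring K] [Algebra S K] (n : ℕ) (i : Fin n)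
    (x : Fin n → K) (j : Fin 1) : ev K (proj (S := S) n i) x j = x i := by
  induction n with
  | zero => exact i.elim0
  | succ n ih =>
    obtain ⟨y, z, rfl⟩ := exists_eq_pair (A := obj S n) (B := obj S 1) x
    refine Fin.lastCases ?_ (fun i => ?_) i
    · rw [proj_last, ev_snd]
      obtain rfl : j = 0 := Subsingleton.elim _ _
      simp [pair, join]
    · rw [proj_castSucc, ev_comp, ev_fst, ih]
      simp [pair, join]

/-- Every polynomial function is denoted by a circuit. -/
theorem exists_ev_eq_aeval {A : PolyCirc S} (p : MvPolynomial (Fin A.wires) S) :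
    ∃ f : A ⟶ obj S 1, ∀ (K : Type u) [CommSemiring K] [Algebra S K] (x : Pt K A),
      ev K f x = fun _ => MvPolynomial.aeval x p := by
  induction p using MvPolynomial.induction_on with
  | C s => exact ⟨toUnit A ≫ const s, fun K _ _ x => by simp [ev_const]⟩
  | add p q hp hq =>
    obtain ⟨f, hf⟩ := hp
    obtain ⟨g, hg⟩ := hq
    exact ⟨lift f g ≫ add _, fun K _ _ x => by rw [ev_comp, ev_lift, ev_add, hf, hg, map_add]; rfl⟩
  | mul_X p i hp =>
    obtain ⟨f, hf⟩ := hp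
    exact ⟨lift f (proj _ i) ≫ mul _, fun K _ _ x => by
      rw [ev_comp, ev_lift, ev_mul, hf, map_mul, MvPolynomial.aeval_X]
      funext j
      exact congrArg (MvPolynomial.aeval x p * ·) (ev_proj (S := S) _ i x j)⟩

/-- Every tuple of polynomials is denoted by a circuit. -/
theorem exists_ev_eq_aeval_tuple {A : PolyCirc S} {n : ℕ}
    (p : Fin n → MvPolynomial (Fin A.wires) S) :
    ∃ f : A ⟶ obj S n, ∀ (K : Type u) [CommSemiring K] [Algebra S K] (x : Pt K A),
      ev K f x = fun i => MvPolynomial.aeval x (p i) := by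
  induction n with
  | zero => exact ⟨toUnit A, fun _ _ _ _ => funext fun i => i.elim0⟩
  | succ n ih =>
    obtain ⟨f, hf⟩ := ih fun i => p i.castSucc
    obtain ⟨g, hg⟩ := exists_ev_eq_aeval (p (Fin.last n))
    refine ⟨lift f g, fun K _ _ x => (ev_lift (K := K) f g x).trans ?_⟩
    rw [hf, hg]
    funext i
    refine Fin.lastCases ?_ (fun i => ?_) i
    · simp [pair, join]
    · simp [pair, join]

end Completeness

/-! ### Derivatives of circuits -/

section Derivative

open CartesianLeftAdditiveCategory CartesianDistributiveCategory TrivSqZeroExt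

variable {K : Type u} [CommSemiring K] {A B A' B' Z : PolyCirc S}

/-- The point over the dual numbers with given value and direction. -/
def dual (x a : Pt K A) : Pt (DualNumber K) A := fun i => inl (x i) + inr (a i)

theorem dual_pair (x a : Pt K A) (y b : Pt K B) :
    dual (pair x y) (pair a b) = pair (dual x a) (dual y b) := by
  funext i
  simp only [dual, pair, join]
  split_ifs <;> rfl

theorem dual_inj {x a x' a' : Pt K A} : dual x a = dual x' a' ↔ x = x' ∧ a = a' := by
  refine ⟨fun h => ⟨funext fun i => ?_, funext fun i => ?_⟩, fun h => by rw [h.1, h.2]⟩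
  · simpa [dual] using congrArg TrivSqZeroExt.fst (congrFun h i)
  · simpa [dual] using congrArg TrivSqZeroExt.snd (congrFun h i)

variable [Algebra S K]

/-- The directional derivative of the map denoted by a circuit. -/
def tangent (f : A ⟶ B) (x a : Pt K A) : Pt K B := fun j => (ev (DualNumber K) f (dual x a) j).snd

theorem ev_dual (f : A ⟶ B) (x a : Pt K A) :
    ev (DualNumber K) f (dual x a) = dual (ev K f x) (tangent f x a) := by
  have h : ∀ j, (ev (DualNumber K) f (dual x a) j).fst = ev K f x j := fun j => by
    -- The projection `ε ↦ 0` is a homomorphism of algebras, so evaluation commutes with it.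
    have := map_ev (fstHom S K K) f (dual x a) j
    simpa [dual] using this
  funext j
  rw [dual, ← h j]
  exact (inl_fst_add_inr_snd_eq _).symm

/-- Turns each evaluation rule over the dual numbers into the derivative rule of the same map; the
value `y` is a by-product. -/
theorem tangent_eq {f : A ⟶ B} {x a : Pt K A} {y b : Pt K B}
    (h : ev (DualNumber K) f (dual x a) = dual y b) : tangent f x a = b :=
  (dual_inj.1 ((ev_dual f x a).symm.trans h)).2

@[simp] theorem tangent_id (x a : Pt K A) : tangent (𝟙 A) x a = a :=
  tangent_eq (ev_id _)

@[simp] theorem tangent_comp (f : A ⟶ B) (g : B ⟶ Z) (x a : Pt K A) :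
    tangent (f ≫ g) x a = tangent g (ev K f x) (tangent f x a) :=
  tangent_eq (by rw [ev_comp, ev_dual, ev_dual])

@[simp] theorem tangent_tensorHom (f : A ⟶ A') (g : B ⟶ B') (x a : Pt K A) (y b : Pt K B) :
    tangent (f ⊗ₘ g) (pair x y) (pair a b) = pair (tangent f x a) (tangent g y b) :=
  tangent_eq (by rw [dual_pair, ev_tensorHom, ev_dual, ev_dual, ← dual_pair])

@[simp] theorem tangent_lift (f : Z ⟶ A) (g : Z ⟶ B) (x a : Pt K Z) :
    tangent (lift f g) x a = pair (tangent f x a) (tangent g x a) :=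
  tangent_eq (by rw [ev_lift, ev_dual, ev_dual, ← dual_pair])

@[simp] theorem tangent_associator (x a : Pt K A) (y b : Pt K B) (z c : Pt K Z) :
    tangent (α_ A B Z).hom (pair (pair x y) z) (pair (pair a b) c) = pair a (pair b c) :=
  tangent_eq (by rw [dual_pair, dual_pair, ev_associator_hom, ← dual_pair, ← dual_pair])

@[simp] theorem tangent_leftUnitor (u v : Pt K (𝟙_ (PolyCirc S))) (x a : Pt K A) :
    tangent (λ_ A).hom (pair u x) (pair v a) = a :=
  tangent_eq (by rw [dual_pair, ev_leftUnitor_hom])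

@[simp] theorem tangent_rightUnitor (u v : Pt K (𝟙_ (PolyCirc S))) (x a : Pt K A) :
    tangent (ρ_ A).hom (pair x u) (pair a v) = a :=
  tangent_eq (by rw [dual_pair, ev_rightUnitor_hom])

@[simp] theorem tangent_braiding (x a : Pt K A) (y b : Pt K B) :
    tangent (β_ A B).hom (pair x y) (pair a b) = pair b a :=
  tangent_eq (by rw [dual_pair, ev_braiding, ← dual_pair])

@[simp] theorem tangent_add (x a y b : Pt K A) :
    tangent (add A) (pair x y) (pair a b) = a + b := by
  refine tangent_eq (y := x + y) ?_
  rw [dual_pair, ev_add]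
  funext i
  ext <;> simp [dual]

@[simp] theorem tangent_mul (x a y b : Pt K A) :
    tangent (mul A) (pair x y) (pair a b) = x * b + y * a := by
  refine tangent_eq (y := x * y) ?_
  rw [dual_pair, ev_mul]
  funext i
  ext <;> simp [dual, _root_.mul_comm]

/-! ### Jacobians and their transposes. -/

/-- The polynomials denoted by a circuit. -/
noncomputable def poly (f : A ⟶ B) (j : Fin B.wires) : MvPolynomial (Fin A.wires) S :=
  ev (MvPolynomial (Fin A.wires) S) f MvPolynomial.X j

/-- `MvPolynomial.aeval x` is a homomorphism of algebras that carries the variables to `x`, and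
evaluation commutes with it. -/
theorem ev_eq_aeval (f : A ⟶ B) (x : Pt K A) (j : Fin B.wires) :
    ev K f x j = MvPolynomial.aeval x (poly f j) := by
  rw [poly, map_ev]
  simp

/-- Taylor expansion with `ε² = 0`. In the induction, multiplication by a variable is the Leibniz
rule. -/
theorem aeval_dual (x a : Pt K A) (p : MvPolynomial (Fin A.wires) S) :
    MvPolynomial.aeval (dual x a) p = (inl (MvPolynomial.aeval x p) +
      inr (∑ i, MvPolynomial.aeval x (MvPolynomial.pderiv i p) * a i) : DualNumber K) := by
  induction p using MvPolynomial.induction_on with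
  | C s => simp [algebraMap_eq_inl']
  | add p q hp hq =>
    rw [map_add, hp, hq]
    ext <;> simp [_root_.add_mul, Finset.sum_add_distrib]
  | mul_X p k hp =>
    rw [map_mul, hp, MvPolynomial.aeval_X]
    ext
    · simp [dual]
    · simp [dual, MvPolynomial.pderiv_X, Pi.single_apply, _root_.add_mul, Finset.sum_add_distrib,
        _root_.mul_assoc, apply_ite, ite_mul, Finset.sum_mul, _root_.mul_comm (x k)]

theorem tangent_eq_sum (f : A ⟶ B) (x a : Pt K A) (j : Fin B.wires) :
    tangent f x a j = ∑ i, MvPolynomial.aeval x (MvPolynomial.pderiv i (poly f j)) * a i := by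
  rw [tangent, ev_eq_aeval, aeval_dual]
  simp

theorem pair_dotProduct_pair (x a : Pt K A) (y b : Pt K B) :
    dotProduct (pair x y) (pair a b) = dotProduct x a + dotProduct y b := by
  refine (Fin.sum_univ_add (a := A.wires) (b := B.wires) _).trans ?_
  exact congrArg₂ (· + ·)
    (congrArg₂ dotProduct (left_pair x y) (left_pair a b))
    (congrArg₂ dotProduct (right_pair x y) (right_pair a b))

theorem exists_reverse (f : A ⟶ B) : ∃ r : A ⊗ B ⟶ A,
    ∀ (K : Type u) [CommSemiring K] [Algebra S K] (x : Pt K A) (d : Pt K B), ev K r (pair x d) =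
      fun i => ∑ j, MvPolynomial.aeval x (MvPolynomial.pderiv i (poly f j)) * d j := by
  obtain ⟨r, hr⟩ := exists_ev_eq_aeval_tuple (A := A ⊗ B) (n := A.wires) fun i =>
    -- The transposed Jacobian times `d`, as polynomials in the wires of `A ⊗ B`: the first
    -- `A.wires` variables stand for `x`, the others for `d`.
    ∑ j, MvPolynomial.rename (Fin.castAdd B.wires) (MvPolynomial.pderiv i (poly f j)) *
      MvPolynomial.X (Fin.natAdd A.wires j)
  refine ⟨r, fun K _ _ x d => (hr K (pair x d)).trans (funext fun i => ?_)⟩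
  rw [map_sum]
  refine Finset.sum_congr rfl fun j _ => ?_
  rw [map_mul, MvPolynomial.aeval_rename, MvPolynomial.aeval_X]
  exact congrArg₂ (fun x d => MvPolynomial.aeval x _ * d) (left_pair x d)
    (congrFun (right_pair x d) j)

/-- The reverse derivative of a circuit. -/
noncomputable def reverse (f : A ⟶ B) : A ⊗ B ⟶ A := (exists_reverse f).choose

theorem ev_reverse (f : A ⟶ B) (x : Pt K A) (d : Pt K B) (i : Fin A.wires) :
    ev K (reverse f) (pair x d) i =
      ∑ j, MvPolynomial.aeval x (MvPolynomial.pderiv i (poly f j)) * d j :=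
  congrFun ((exists_reverse f).choose_spec K x d) i

/-- The reverse derivative is the transpose of the directional derivative. -/
theorem reverse_dotProduct (f : A ⟶ B) (x a : Pt K A) (d : Pt K B) :
    dotProduct (ev K (reverse f) (pair x d)) a = dotProduct d (tangent f x a) := by
  simp only [dotProduct, ev_reverse, tangent_eq_sum, Finset.sum_mul, Finset.mul_sum]
  rw [Finset.sum_comm]
  exact Finset.sum_congr rfl fun j _ => Finset.sum_congr rfl fun i _ => by ring

theorem ext_ev_pair {f g : A ⊗ B ⟶ Z}
    (h : ∀ (K : Type u) [CommSemiring K] [Algebra S K] (x : Pt K A) (y : Pt K B),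
      ev K f (pair x y) = ev K g (pair x y)) : f = g :=
  ext_ev fun K _ _ z => by
    obtain ⟨x, y, rfl⟩ := exists_eq_pair z
    exact h K x y

/-- Pairing against all `a` determines a vector over any commutative semiring, so the adjunction
with `tangent f` pins down `reverse f` on points, hence as a circuit. -/
theorem reverse_eq {f : A ⟶ B} {g : A ⊗ B ⟶ A}
    (h : ∀ (K : Type u) [CommSemiring K] [Algebra S K] (x a : Pt K A) (d : Pt K B),
      dotProduct (ev K g (pair x d)) a = dotProduct d (tangent f x a)) : reverse f = g :=
  ext_ev_pair fun K _ _ x d => dotProduct_eq _ _ fun a => by rw [reverse_dotProduct, h]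

/-- `R[f](x, d)` is linear in `d`, so moving only `d`, in the direction `d'`, gives back its value
at `d'`. -/
theorem tangent_reverse (f : A ⟶ B) (x : Pt K A) (d d' : Pt K B) :
    tangent (reverse f) (pair x d) (pair 0 d') = ev K (reverse f) (pair x d') := by
  funext i
  rw [tangent, dual_pair, ev_reverse, ev_reverse]
  simp only [aeval_dual]
  rw [snd_sum]
  refine Finset.sum_congr rfl fun j _ => ?_
  simp [dual]

/-- Transposing twice: the second component of `R[R[f]]((x, 0), a)`, paired with `v`, equals `⟨a,
R[f](x, v)⟩` by the adjunction and linearity, hence `⟨v, tangent f x a⟩` by the adjunction again. -/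
theorem ev_forwardDerivative (f : A ⟶ B) (x a : Pt K A) :
    ev K (forwardDerivative reverse f) (pair x a) = tangent f x a := by
  obtain ⟨u, w, h⟩ := exists_eq_pair (ev K (reverse (reverse f)) (pair (pair x 0) a))
  refine dotProduct_eq _ _ fun v => ?_
  -- The zero in the test vector `(0, v)` eliminates the unwanted component `u`.
  have h' : dotProduct (pair u w) (pair 0 v) = dotProduct v (tangent f x a) := by
    rw [← h, reverse_dotProduct, tangent_reverse, dotProduct_comm, reverse_dotProduct]
  rw [pair_dotProduct_pair, dotProduct_zero, _root_.zero_add] at h'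
  rw [dotProduct_comm (tangent f x a) v, ← h', forwardDerivative]
  rw [ev_comp, ev_comp, ev_whiskerRight, ev_comp, ev_rightUnitor_inv 0, ev_whiskerLeft, ev_zero, h,
    ev_snd]

/-- Differentiating `∑ ∂ᵢf(x) aᵢ` in the direction `(b, c)` gives the Hessian at `(b, a)` plus the
Jacobian applied to `c`. Only the Hessian term involves `a` and `b`, so exchanging them amounts to
`pderiv_comm`. -/
theorem tangent_forwardDerivative (f : A ⟶ B) (x a b c : Pt K A) (j : Fin B.wires) :
    tangent (forwardDerivative reverse f) (pair x a) (pair b c) j =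
      ∑ i, ∑ k, MvPolynomial.aeval x
          (MvPolynomial.pderiv k (MvPolynomial.pderiv i (poly f j))) * b k * a i +
        ∑ i, MvPolynomial.aeval x (MvPolynomial.pderiv i (poly f j)) * c i := by
  rw [tangent, dual_pair, ev_forwardDerivative, tangent_eq_sum]
  simp only [aeval_dual]
  rw [snd_sum, ← Finset.sum_add_distrib]
  refine Finset.sum_congr rfl fun i _ => ?_
  rw [← Finset.sum_mul, _root_.add_comm]
  simp [dual, _root_.add_comm]

theorem pderiv_comm {σ : Type*} (i k : σ) (p : MvPolynomial σ S) :
    MvPolynomial.pderiv i (MvPolynomial.pderiv k p) =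
      MvPolynomial.pderiv k (MvPolynomial.pderiv i p) := by
  classical
  induction p using MvPolynomial.induction_on with
  | C s => simp
  | add p q hp hq => simp [hp, hq]
  | mul_X p l hp =>
    rcases eq_or_ne l k with rfl | hk <;> rcases eq_or_ne l i with rfl | hi <;>
      simp [*, _root_.add_comm]

theorem tangent_forwardDerivative_symm (f : A ⟶ B) (x a b c : Pt K A) :
    tangent (forwardDerivative reverse f) (pair x a) (pair b c) =
      tangent (forwardDerivative reverse f) (pair x b) (pair a c) := by
  funext j
  rw [tangent_forwardDerivative, tangent_forwardDerivative]
  refine congrArg (· + _) ?_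
  rw [Finset.sum_comm]
  refine Finset.sum_congr rfl fun i _ => Finset.sum_congr rfl fun k _ => ?_
  rw [pderiv_comm, mul_right_comm]

theorem forwardDerivative_symm (f : A ⟶ B) :
    forwardDerivative reverse (forwardDerivative reverse f) =
      tensorμ A A A A ≫ forwardDerivative reverse (forwardDerivative reverse f) := by
  refine ext_ev_pair fun K _ _ x d => ?_
  obtain ⟨x, a, rfl⟩ := exists_eq_pair x
  obtain ⟨b, c, rfl⟩ := exists_eq_pair d
  rw [ev_comp, ev_tensorμ, ev_forwardDerivative, ev_forwardDerivative,
    tangent_forwardDerivative_symm]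

/-! ### The axioms of a reverse derivative category, and the reverse derivative of multiplication.
-/

variable (S) in
/-- Polynomial circuits form a reverse derivative category. -/
noncomputable def reverseDerivativeCategory : ReverseDerivativeCategory (PolyCirc S) where
  R f := reverse f
  R_id A := reverse_eq fun K _ _ x a d => by simp
  R_associator A B Z := reverse_eq fun K _ _ x a d => by
    obtain ⟨x, z, rfl⟩ := exists_eq_pair x
    obtain ⟨x, y, rfl⟩ := exists_eq_pair x
    obtain ⟨a, c, rfl⟩ := exists_eq_pair a
    obtain ⟨a, b, rfl⟩ := exists_eq_pair a
    obtain ⟨d, e, rfl⟩ := exists_eq_pair d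
    obtain ⟨e, e', rfl⟩ := exists_eq_pair e
    simp [pair_dotProduct_pair, _root_.add_assoc]
  R_leftUnitor A := reverse_eq fun K _ _ x a d => by
    obtain ⟨u, x, rfl⟩ := exists_eq_pair x
    obtain ⟨v, a, rfl⟩ := exists_eq_pair a
    simp [pair_dotProduct_pair, ev_leftUnitor_inv 0]
  R_rightUnitor A := reverse_eq fun K _ _ x a d => by
    obtain ⟨x, u, rfl⟩ := exists_eq_pair x
    obtain ⟨a, v, rfl⟩ := exists_eq_pair a
    simp [pair_dotProduct_pair, ev_rightUnitor_inv 0]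
  R_braiding A B := reverse_eq fun K _ _ x a d => by
    obtain ⟨x, y, rfl⟩ := exists_eq_pair x
    obtain ⟨a, b, rfl⟩ := exists_eq_pair a
    obtain ⟨d, e, rfl⟩ := exists_eq_pair d
    simp [pair_dotProduct_pair, _root_.add_comm]
  R_copy A := reverse_eq fun K _ _ x a d => by
    obtain ⟨d, e, rfl⟩ := exists_eq_pair d
    simp [pair_dotProduct_pair]
  R_discard A := reverse_eq fun K _ _ x a d => by
    rw [ev_comp, ev_zero, zero_dotProduct]
    -- The change `d` lies in the unit object, so its dot product is an empty sum.
    exact (Fin.sum_univ_zero _).symm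
  R_add A := reverse_eq fun K _ _ x a d => by
    obtain ⟨x, y, rfl⟩ := exists_eq_pair x
    obtain ⟨a, b, rfl⟩ := exists_eq_pair a
    simp [pair_dotProduct_pair]
  R_zero A := toUnit_unique _ _
  -- The chain rule for tangents, transposed by applying the adjunction for `f` and then for `g`.
  R_comp f g := reverse_eq fun K _ _ x a d => by
    simp [reverse_dotProduct]
  R_tensor f g := reverse_eq fun K _ _ x a d => by
    obtain ⟨x, y, rfl⟩ := exists_eq_pair x
    obtain ⟨a, b, rfl⟩ := exists_eq_pair a
    obtain ⟨d, e, rfl⟩ := exists_eq_pair d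
    simp [pair_dotProduct_pair, reverse_dotProduct]
  R_change_add f := ext_ev_pair fun K _ _ x d => by
    obtain ⟨d, e, rfl⟩ := exists_eq_pair d
    refine dotProduct_eq _ _ fun a => ?_
    simp [add_dotProduct, reverse_dotProduct]
  R_change_zero f := ext_ev_pair fun K _ _ x d => by
    refine dotProduct_eq _ _ fun a => ?_
    simp [reverse_dotProduct]
  R_change_linear f := ext_ev_pair fun K _ _ x d => by
    obtain ⟨d, e, rfl⟩ := exists_eq_pair d
    rw [partialDerivative, ev_comp, ev_lift, ev_forwardDerivative, ev_whiskerLeft, ev_tensorHom,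
      ev_comp, ev_zero, ev_fst, ev_snd, tangent_reverse, ev_comp, ev_whiskerLeft, ev_snd]
  partials_symm f := forwardDerivative_symm f

theorem reverse_mul (A : PolyCirc S) : reverse (mul A) =
    lift (snd A A ▷ A ≫ mul A) (fst A A ▷ A ≫ mul A) := by
  refine reverse_eq fun K _ _ x a d => ?_
  obtain ⟨x, y, rfl⟩ := exists_eq_pair x
  obtain ⟨a, b, rfl⟩ := exists_eq_pair a
  simp only [ev_lift, ev_comp, ev_whiskerRight, ev_fst, ev_snd, ev_mul, tangent_mul,
    pair_dotProduct_pair]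
  simp only [dotProduct, ← Finset.sum_add_distrib, Pi.add_apply, Pi.mul_apply]
  exact Finset.sum_congr rfl fun i _ => by ring

end Derivative

end PolyCirc

theorem proposition4 (S : Type u) [CommSemiring S] :
    ∃ 𝓡 : ReverseDerivativeCategory (PolyCirc S),
      (∀ A : PolyCirc S, 𝓡.R (CartesianDistributiveCategory.mul A) =
        lift (snd A A ▷ A ≫ CartesianDistributiveCategory.mul A)
          (fst A A ▷ A ≫ CartesianDistributiveCategory.mul A)) ∧
      (∀ A : PolyCirc S,
        𝓡.R (CartesianDistributiveCategory.one A) = (λ_ A).hom ≫ toUnit A) ∧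
      ∀ s : S, 𝓡.R (PolyCirc.const s) =
        (λ_ (PolyCirc.obj S 1)).hom ≫ toUnit (PolyCirc.obj S 1) := by
  -- The reverse derivatives of units and constants land in the terminal object, where any two maps
  -- agree.
  exact ⟨PolyCirc.reverseDerivativeCategory S, PolyCirc.reverse_mul,
    fun _ => toUnit_unique _ _, fun _ => toUnit_unique _ _⟩
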